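/- Let $\mathbf x$ be an almost surely bounded random vector in $\mathbb R^n$ having a continuous probability density $p_{\mathbf x}$ with respect to Lebesgue measure, let $\mathbf v\sim\mathcal N(0,\mathbf I)$ be a standard Gaussian vector in $\mathbb R^n$ independent of $\mathbf x$, let $\sigma>0$, and put $\mathbf y=\mathbf x+\sigma\mathbf v$. For $\gamma>0$ let $$m_\gamma(t)=1-\frac{1}{(\pi\gamma^2)^{n/2}}\exp\left(-\frac{t^2}{\gamma^2}\right).$$ Then for every measurable $f:\mathbb R^n\to\mathbb R^n$ the limit $$L(f)=\lim_{\gamma\searrow0}\mathbb E_{\mathbf x,\mathbf y}\left[m_\gamma(\|f(\mathbf y)-\mathbf x\|_2)\right]$$ exists in $\mathbb R$, and $L$ attains its minimum over all measurable $f$. If $f^*$ is any measurable minimizer of $L$, then for Lebesgue-almost every $y\in\mathbb R^n$ the conditional distribution of $\mathbf x$ given $\mathbf y=y$ has a (necessarily unique) continuous density $p_{\mathbf x\mid \mathbf y=y}$, and $$\operatorname*{argmax}_{c\in\mathbb R^n}p_{\mathbf x\mid \mathbf y=y}(c)=\{f^*(y)\}=\operatorname{prox}_{-\sigma^2\log p_{\mathbf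 x}}(y),$$ where, for $R:\mathbb R^n\to\mathbb R\cup\{+\infty\}$, $\operatorname{prox}_R(y)=\operatorname*{argmin}_{c\in\mathbb R^n}\left(\tfrac12\|y-c\|_2^2+R(c)\right)$ is the set of global minimizers, and $-\sigma^2\log p_{\mathbf x}(c)=+\infty$ where $p_{\mathbf x}(c)=0$. -/

import Mathlib

open MeasureTheory ProbabilityTheory Filter Topology

/-- `q` is a continuous probability density, with respect to Lebesgue measure, of the
measure `μ`. Continuous densities of a given measure are unique. -/
structure IsContinuousDensity {n : ℕ} (μ : Measure (EuclideanSpace ℝ (Fin n)))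
    (q : EuclideanSpace ℝ (Fin n) → ℝ) : Prop where
  continuous : Continuous q
  nonneg : ∀ c, 0 ≤ q c
  eq_withDensity : μ = volume.withDensity fun c => ENNReal.ofReal (q c)

/-- The loss `m_γ(t) = 1 - (π γ²)^(-n/2) exp(-t² / γ²)`. -/
noncomputable def proxMatchingLoss (n : ℕ) (γ t : ℝ) : ℝ :=
  1 - 1 / (Real.pi * γ ^ 2) ^ ((n : ℝ) / 2) * Real.exp (-(t ^ 2 / γ ^ 2))

/-- The expected proximal matching loss `E[m_γ(‖f(Y) - X‖₂)]` of the denoiser `f`. -/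
noncomputable def expectedLoss {Ω : Type*} [MeasurableSpace Ω] {n : ℕ} (P : Measure Ω)
    (X Y : Ω → EuclideanSpace ℝ (Fin n))
    (f : EuclideanSpace ℝ (Fin n) → EuclideanSpace ℝ (Fin n)) (γ : ℝ) : ℝ :=
  ∫ ω, proxMatchingLoss n γ ‖f (Y ω) - X ω‖ ∂P

/-- `ℓ` is the limit, as `γ ↘ 0`, of the expected proximal matching loss of `f`. -/
def HasLimitLoss {Ω : Type*} [MeasurableSpace Ω] {n : ℕ} (P : Measure Ω)
    (X Y : Ω → EuclideanSpace ℝ (Fin n))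
    (f : EuclideanSpace ℝ (Fin n) → EuclideanSpace ℝ (Fin n)) (ℓ : ℝ) : Prop :=
  Tendsto (expectedLoss P X Y f) (𝓝[>] 0) (𝓝 ℓ)

/-- `f` minimizes the limit loss among all measurable functions. -/
def IsLimitLossMinimizer {Ω : Type*} [MeasurableSpace Ω] {n : ℕ} (P : Measure Ω)
    (X Y : Ω → EuclideanSpace ℝ (Fin n))
    (f : EuclideanSpace ℝ (Fin n) → EuclideanSpace ℝ (Fin n)) : Prop :=
  Measurable f ∧ ∃ ℓ, HasLimitLoss P X Y f ℓ ∧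
    ∀ g, Measurable g → ∀ ℓ', HasLimitLoss P X Y g ℓ' → ℓ ≤ ℓ'

/-- The set of global maximizers of `q`. -/
def argmaxSet {E : Type*} (q : E → ℝ) : Set E := {c | ∀ z, q z ≤ q c}

/-- The set-valued proximal operator of an extended-real-valued function `R` at `y`:
the set of global minimizers of `c ↦ ‖y - c‖² / 2 + R c`. -/
def proxSet {n : ℕ} (R : EuclideanSpace ℝ (Fin n) → EReal) (y : EuclideanSpace ℝ (Fin n)) :
    Set (EuclideanSpace ℝ (Fin n)) :=
  {c | ∀ z, ((1 / 2 * ‖y - c‖ ^ 2 : ℝ) : EReal) + R c ≤ ((1 / 2 * ‖y - z‖ ^ 2 : ℝ) : EReal) + R z}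

/-- The function `-σ² log p`, with value `+∞` where `p` vanishes. -/
noncomputable def scaledNegLog {n : ℕ} (σ : ℝ) (p : EuclideanSpace ℝ (Fin n) → ℝ)
    (c : EuclideanSpace ℝ (Fin n)) : EReal :=
  -(((σ ^ 2 : ℝ) : EReal) * ENNReal.log (ENNReal.ofReal (p c)))

/-! Write J(y, c) = p(c) k(y - c) for the joint density of observation and signal, k being the
density of σv. Since 1 - m_γ is a Gaussian probability density of width γ, the expected loss is 1 -
∫∫ K_γ(f(y) - c) J(y, c) dc dy. As γ ↘ 0 the kernels K_γ form an approximate identity, and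
boundedness of the signal gives J(y, c) ≤ D g(y) with g Gaussian, so dominated convergence yields
L(f) = 1 - ∫ J(y, f(y)) dy (`hasLimitLoss_of_measurable`). Minimizing L therefore means maximizing
J(y, ·) for almost every y.

The crux is that this maximizer is almost everywhere unique and measurable in y
(`exists_measurable_argmaxSet_jointDensity_eq_singleton`). Up to the term ‖y‖² / (2σ²), log J(y, c)
is affine in y with slope c / σ², so its supremum ψ over c is convex and Lipschitz. By Rademacher ψ
is differentiable almost everywhere, and there every maximizer c equals σ² ∇ψ(y).

Finally, the posterior density is J(y, ·) divided by its positive integral, and the proximal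
objective is a constant minus σ² log J(y, ·), so all three optimization problems have the same
solutions. -/

/-- The Gaussian probability density `(π s)^(-n/2) exp(-‖z‖² / s)`. -/
noncomputable def gaussKernel {n : ℕ} (s : ℝ) (z : EuclideanSpace ℝ (Fin n)) : ℝ :=
  1 / (Real.pi * s) ^ ((n : ℝ) / 2) * Real.exp (-(‖z‖ ^ 2 / s))

/-! ### Gaussian densities: normalization, law of σv, approximate identity. -/

section GaussKernel

variable {n : ℕ} {s : ℝ}

lemma gaussKernel_pos (hs : 0 < s) (z : EuclideanSpace ℝ (Fin n)) : 0 < gaussKernel s z := by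
  unfold gaussKernel
  have := Real.pi_pos
  positivity

lemma continuous_gaussKernel (s : ℝ) :
    Continuous (gaussKernel s : EuclideanSpace ℝ (Fin n) → ℝ) := by
  unfold gaussKernel
  fun_prop

lemma integral_gaussKernel (hs : 0 < s) :
    ∫ z : EuclideanSpace ℝ (Fin n), gaussKernel s z = 1 := by
  have h := GaussianFourier.integral_rexp_neg_mul_sq_norm
    (V := EuclideanSpace ℝ (Fin n)) (b := s⁻¹) (by positivity)
  simp only [finrank_euclideanSpace, Fintype.card_fin, div_inv_eq_mul] at h
  have hpos : 0 < (Real.pi * s) ^ ((n : ℝ) / 2) := by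
    have := Real.pi_pos
    positivity
  unfold gaussKernel
  rw [integral_const_mul, one_div, inv_mul_eq_one₀ hpos.ne', ← h]
  congr! 3
  ring

lemma integrable_gaussKernel (hs : 0 < s) :
    Integrable (gaussKernel s : EuclideanSpace ℝ (Fin n) → ℝ) :=
  integrable_of_integral_eq_one (integral_gaussKernel hs)

lemma lintegral_gaussKernel (hs : 0 < s) :
    ∫⁻ z : EuclideanSpace ℝ (Fin n), ENNReal.ofReal (gaussKernel s z) = 1 := by
  rw [← ofReal_integral_eq_lintegral_ofReal (integrable_gaussKernel hs)
    (ae_of_all _ fun z => (gaussKernel_pos hs z).le), integral_gaussKernel hs, ENNReal.ofReal_one]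

lemma map_smul_stdGaussian_eq_withDensity {σ : ℝ} (hσ : 0 < σ) :
    (stdGaussian (EuclideanSpace ℝ (Fin n))).map (σ • ·) =
      volume.withDensity fun z => ENNReal.ofReal (gaussKernel (2 * σ ^ 2) z) := by
  have hs : 0 < 2 * σ ^ 2 := by positivity
  have : IsProbabilityMeasure ((volume : Measure (EuclideanSpace ℝ (Fin n))).withDensity
      fun z => ENNReal.ofReal (gaussKernel (2 * σ ^ 2) z)) :=
    ⟨by rw [withDensity_apply _ MeasurableSet.univ, Measure.restrict_univ,
      lintegral_gaussKernel hs]⟩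
  have : IsProbabilityMeasure ((stdGaussian (EuclideanSpace ℝ (Fin n))).map (σ • ·)) :=
    Measure.isProbabilityMeasure_map (by fun_prop)
  refine Measure.ext_of_charFun (funext fun t => ?_)
  rw [charFun_map_smul, charFun_stdGaussian, charFun_apply]
  rw [integral_withDensity_eq_integral_toReal_smul
    (continuous_gaussKernel _).measurable.ennreal_ofReal (by simp)]
  have h := GaussianFourier.integral_cexp_neg_mul_sq_norm_add
    (V := EuclideanSpace ℝ (Fin n)) (b := ((2 * σ ^ 2)⁻¹ : ℝ))
    (by rw [Complex.ofReal_re]; positivity) Complex.I t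
  simp only [finrank_euclideanSpace, Fintype.card_fin] at h
  have hpos : 0 < (Real.pi * (2 * σ ^ 2)) ^ ((n : ℝ) / 2) := by
    have := Real.pi_pos
    positivity
  have hcpow : ((Real.pi : ℂ) / (((2 * σ ^ 2)⁻¹ : ℝ) : ℂ)) ^ ((n : ℂ) / 2) =
      (((Real.pi * (2 * σ ^ 2)) ^ ((n : ℝ) / 2) : ℝ) : ℂ) := by
    rw [Complex.ofReal_cpow (by have := Real.pi_pos; positivity)]
    push_cast
    rw [div_inv_eq_mul]
  have heq : ∀ x : EuclideanSpace ℝ (Fin n),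
      (ENNReal.ofReal (gaussKernel (2 * σ ^ 2) x)).toReal •
        Complex.exp ((inner ℝ x t : ℝ) * Complex.I) =
      ((1 / (Real.pi * (2 * σ ^ 2)) ^ ((n : ℝ) / 2) : ℝ) : ℂ) *
        Complex.exp (-(((2 * σ ^ 2)⁻¹ : ℝ) : ℂ) * ‖x‖ ^ 2 + Complex.I * (inner ℝ t x : ℝ)) := by
    intro x
    rw [ENNReal.toReal_ofReal (gaussKernel_pos hs x).le, gaussKernel, Complex.real_smul,
      Complex.exp_add, real_inner_comm]
    push_cast
    rw [mul_assoc]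
    congr 3
    · ring
    · ring
  simp_rw [heq]
  rw [integral_const_mul, h, hcpow, ← mul_assoc, ← Complex.ofReal_mul, one_div,
    inv_mul_cancel₀ hpos.ne', Complex.ofReal_one, one_mul, norm_smul, Complex.I_sq]
  congr 1
  rw [Real.norm_of_nonneg hσ.le]
  push_cast
  have : (σ : ℂ) ≠ 0 := by exact_mod_cast hσ.ne'
  field_simp
  norm_num

/-- Gaussian kernels form an approximate identity as the width tends to zero. -/
lemma tendsto_integral_gaussKernel_mul {q : EuclideanSpace ℝ (Fin n) → ℝ}
    (hq : Integrable q) (hc : Continuous q) (x₀ : EuclideanSpace ℝ (Fin n)) :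
    Tendsto (fun γ : ℝ => ∫ x, gaussKernel (γ ^ 2) (x₀ - x) * q x) (𝓝[>] 0) (𝓝 (q x₀)) := by
  have hdecay : Tendsto (fun x : EuclideanSpace ℝ (Fin n) =>
      ‖x‖ ^ Module.finrank ℝ (EuclideanSpace ℝ (Fin n)) * gaussKernel 1 x)
      (Bornology.cobounded _) (𝓝 0) := by
    rw [finrank_euclideanSpace, Fintype.card_fin]
    have h := ((Real.tendsto_pow_mul_exp_neg_atTop_nhds_zero n).comp
      (tendsto_norm_cobounded_atTop (E := EuclideanSpace ℝ (Fin n)))).const_mul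
        (1 / (Real.pi * 1) ^ ((n : ℝ) / 2))
    rw [mul_zero] at h
    refine squeeze_zero' (.of_forall fun x => ?_) ?_ h
    · exact mul_nonneg (by positivity) (gaussKernel_pos one_pos x).le
    · filter_upwards [tendsto_norm_cobounded_atTop.eventually_ge_atTop 1] with x hx
      have hpi := Real.pi_pos
      have hle : Real.exp (-(‖x‖ ^ 2 / 1)) ≤ Real.exp (-‖x‖) :=
        Real.exp_le_exp.2 (by nlinarith)
      calc ‖x‖ ^ n * gaussKernel 1 x
          = 1 / (Real.pi * 1) ^ ((n : ℝ) / 2) * (‖x‖ ^ n * Real.exp (-(‖x‖ ^ 2 / 1))) := by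
            unfold gaussKernel
            ring
        _ ≤ 1 / (Real.pi * 1) ^ ((n : ℝ) / 2) * (‖x‖ ^ n * Real.exp (-‖x‖)) := by gcongr
  -- Dilating the width-one kernel by γ⁻¹, with the factor γ⁻ⁿ, gives the kernel of parameter γ².
  have h := (tendsto_integral_comp_smul_smul_of_integrable' (μ := volume)
    (φ := gaussKernel (n := n) 1)
    (fun x => (gaussKernel_pos one_pos x).le) (integral_gaussKernel one_pos) hdecay hq
    (x₀ := x₀) hc.continuousAt).comp tendsto_inv_nhdsGT_zero
  refine h.congr' ?_
  filter_upwards [self_mem_nhdsWithin] with γ hγ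
  have hγ : 0 < γ := hγ
  refine integral_congr_ae (ae_of_all _ fun x => ?_)
  simp only [smul_eq_mul, gaussKernel, norm_smul, finrank_euclideanSpace, Fintype.card_fin]
  have h1 : (Real.pi * γ ^ 2) ^ ((n : ℝ) / 2) = Real.pi ^ ((n : ℝ) / 2) * γ ^ n := by
    rw [Real.mul_rpow Real.pi_pos.le (by positivity), ← Real.rpow_natCast γ 2,
      ← Real.rpow_mul hγ.le, ← Real.rpow_natCast γ n]
    congr 2
    push_cast
    ring
  rw [h1, norm_inv, Real.norm_of_nonneg hγ.le, mul_one, inv_pow, div_one, mul_pow, inv_pow]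
  field_simp

end GaussKernel

/-- The density at `(y, c)` of the joint law of the observation `x + σ v` and the signal `x`, when
`x` has density `p`. -/
noncomputable def jointDensity {n : ℕ} (p : EuclideanSpace ℝ (Fin n) → ℝ) (σ : ℝ)
    (y c : EuclideanSpace ℝ (Fin n)) : ℝ :=
  p c * gaussKernel (2 * σ ^ 2) (y - c)

/-! ### The joint law of observation and signal. -/

section JointDensity

variable {n : ℕ} {p : EuclideanSpace ℝ (Fin n) → ℝ} {σ : ℝ}

lemma continuous_uncurry_jointDensity (hp : Continuous p) (σ : ℝ) :
    Continuous fun z : EuclideanSpace ℝ (Fin n) × EuclideanSpace ℝ (Fin n) =>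
      jointDensity p σ z.1 z.2 := by
  have := continuous_gaussKernel (n := n) (2 * σ ^ 2)
  unfold jointDensity
  fun_prop

lemma jointDensity_nonneg (hp : ∀ c, 0 ≤ p c) (hσ : 0 < σ) (y c : EuclideanSpace ℝ (Fin n)) :
    0 ≤ jointDensity p σ y c :=
  mul_nonneg (hp c) (gaussKernel_pos (by positivity) _).le

lemma map_prodMk_eq_withDensity_jointDensity {Ω : Type*} [MeasurableSpace Ω] {P : Measure Ω}
    [IsProbabilityMeasure P] {X V Y : Ω → EuclideanSpace ℝ (Fin n)}
    (hX : Measurable X) (hV : Measurable V) (hp : IsContinuousDensity (P.map X) p)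
    (hgauss : P.map V = stdGaussian (EuclideanSpace ℝ (Fin n)))
    (hindep : IndepFun X V P) (hσ : 0 < σ) (hY : ∀ ω, Y ω = X ω + σ • V ω) :
    P.map (fun ω => (Y ω, X ω)) =
      (volume.prod volume).withDensity fun z => ENNReal.ofReal (jointDensity p σ z.1 z.2) := by
  have hW : P.map (fun ω => σ • V ω) =
      volume.withDensity fun z => ENNReal.ofReal (gaussKernel (2 * σ ^ 2) z) := by
    rw [← map_smul_stdGaussian_eq_withDensity hσ, ← hgauss, Measure.map_map (by fun_prop) hV]
    rfl
  have hind : IndepFun X (fun ω => σ • V ω) P :=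
    hindep.comp (ψ := fun v => σ • v) measurable_id (by fun_prop)
  have hkm : Measurable (gaussKernel (2 * σ ^ 2) : EuclideanSpace ℝ (Fin n) → ℝ) :=
    (continuous_gaussKernel _).measurable
  have hpm := hp.continuous.measurable
  have hjoint : P.map (fun ω => (X ω, σ • V ω)) = (volume.prod volume).withDensity
      fun z => ENNReal.ofReal (p z.1) * ENNReal.ofReal (gaussKernel (2 * σ ^ 2) z.2) := by
    rw [(indepFun_iff_map_prod_eq_prod_map_map hX.aemeasurable (by fun_prop)).1 hind, hW,
      hp.eq_withDensity, prod_withDensity hpm.ennreal_ofReal hkm.ennreal_ofReal]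
  have hjm := (continuous_uncurry_jointDensity hp.continuous σ).measurable.ennreal_ofReal
  refine Measure.ext_of_lintegral _ fun F hF => ?_
  have hmap : P.map (fun ω => (Y ω, X ω)) =
      (P.map (fun ω => (X ω, σ • V ω))).map fun z => (z.1 + z.2, z.1) := by
    rw [Measure.map_map (by fun_prop) (by fun_prop)]
    congr 1
    funext ω
    simp [hY]
  rw [hmap, lintegral_map hF (by fun_prop), hjoint,
    lintegral_withDensity_eq_lintegral_mul _ (by fun_prop) (by fun_prop),
    lintegral_withDensity_eq_lintegral_mul _ hjm hF, lintegral_prod _ (by fun_prop),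
    lintegral_prod_symm' _ (by fun_prop)]
  refine lintegral_congr fun x => ?_
  -- Translation invariance in y: the substitution y = x + w undoes the shear (x, w) ↦ (x + w, x).
  conv_rhs => rw [← lintegral_add_left_eq_self _ x]
  refine lintegral_congr fun w => ?_
  simp [jointDensity, ENNReal.ofReal_mul (hp.nonneg x)]

/-- The density of an almost surely bounded random vector vanishes outside a ball. -/
lemma IsContinuousDensity.eq_zero_of_lt_norm {Ω : Type*} [MeasurableSpace Ω] {P : Measure Ω}
    {X : Ω → EuclideanSpace ℝ (Fin n)} (hX : Measurable X) (hp : IsContinuousDensity (P.map X) p)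
    {r : ℝ} (hr : ∀ᵐ ω ∂P, ‖X ω‖ ≤ r) {c : EuclideanSpace ℝ (Fin n)} (hc : r < ‖c‖) : p c = 0 := by
  by_contra hne
  have hU : IsOpen {x : EuclideanSpace ℝ (Fin n) | r < ‖x‖ ∧ 0 < p x} :=
    (isOpen_lt continuous_const continuous_norm).inter (isOpen_lt continuous_const hp.continuous)
  have hpos := hU.measure_pos volume ⟨c, hc, (hp.nonneg c).lt_of_ne' hne⟩
  have h0 : P.map X {x | r < ‖x‖ ∧ 0 < p x} = 0 := by
    rw [Measure.map_apply hX hU.measurableSet]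
    refine measure_mono_null (fun ω hω => ?_) hr
    exact not_le.2 hω.1
  rw [hp.eq_withDensity, withDensity_apply_eq_zero' (by have := hp.continuous; fun_prop)] at h0
  refine hpos.ne' (measure_mono_null (fun x hx => ?_) h0)
  refine ⟨?_, hx⟩
  simpa using hx.2

lemma IsContinuousDensity.exists_pos {μ : Measure (EuclideanSpace ℝ (Fin n))}
    [IsProbabilityMeasure μ] (hp : IsContinuousDensity μ p) : ∃ c, 0 < p c := by
  by_contra! h
  have h1 : μ Set.univ = 1 := measure_univ
  rw [hp.eq_withDensity] at h1
  simp [ENNReal.ofReal_of_nonpos (h _)] at h1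

lemma integral_eq_of_eq_withDensity_jointDensity
    {μ : Measure (EuclideanSpace ℝ (Fin n) × EuclideanSpace ℝ (Fin n))}
    (hp : Continuous p) (hp0 : ∀ c, 0 ≤ p c) (hσ : 0 < σ)
    (hμ : μ = (volume.prod volume).withDensity
      fun z => ENNReal.ofReal (jointDensity p σ z.1 z.2))
    (F : EuclideanSpace ℝ (Fin n) × EuclideanSpace ℝ (Fin n) → ℝ) (hF : Integrable F μ) :
    ∫ z, F z ∂μ = ∫ y, ∫ c, F (y, c) * jointDensity p σ y c := by
  have hjm := (continuous_uncurry_jointDensity hp σ).measurable.ennreal_ofReal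
  subst hμ
  rw [integral_withDensity_eq_integral_toReal_smul hjm (by simp)]
  rw [integrable_withDensity_iff_integrable_smul' hjm (by simp)] at hF
  rw [integral_prod _ hF]
  simp [ENNReal.toReal_ofReal (jointDensity_nonneg hp0 hσ _ _), mul_comm]

end JointDensity

/-! ### Maximizers of the joint density and the proximal operator. -/

section Maximizers

variable {n : ℕ} {p : EuclideanSpace ℝ (Fin n) → ℝ} {σ r : ℝ}

lemma hasCompactSupport_of_eq_zero_of_lt_norm {q : EuclideanSpace ℝ (Fin n) → ℝ}
    (hq : ∀ c, r < ‖c‖ → q c = 0) : HasCompactSupport q :=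
  HasCompactSupport.of_support_subset_isCompact (isCompact_closedBall 0 r) fun c hc => by
    rw [mem_closedBall_zero_iff]
    exact not_lt.1 fun h => hc (hq c h)

lemma continuous_jointDensity (hp : Continuous p) (σ : ℝ) (y : EuclideanSpace ℝ (Fin n)) :
    Continuous (jointDensity p σ y) :=
  (continuous_uncurry_jointDensity hp σ).comp (by fun_prop : Continuous fun c => (y, c))

lemma hasCompactSupport_jointDensity (hr : ∀ c, r < ‖c‖ → p c = 0)
    (y : EuclideanSpace ℝ (Fin n)) : HasCompactSupport (jointDensity p σ y) :=
  hasCompactSupport_of_eq_zero_of_lt_norm (r := r) fun c hc => by simp [jointDensity, hr c hc]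

lemma exists_mem_argmaxSet_jointDensity (hp : Continuous p) (hr : ∀ c, r < ‖c‖ → p c = 0)
    (y : EuclideanSpace ℝ (Fin n)) : ∃ c, c ∈ argmaxSet (jointDensity p σ y) :=
  (continuous_jointDensity hp σ y).exists_forall_ge_of_hasCompactSupport
    (hasCompactSupport_jointDensity hr y)

/-- Expanding ‖y - c‖² cancels the quadratic term in y; what remains is affine in y with slope c /
σ². -/
lemma log_jointDensity_add (hσ : 0 < σ) {c : EuclideanSpace ℝ (Fin n)} (hc : 0 < p c)
    (y : EuclideanSpace ℝ (Fin n)) :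
    Real.log (jointDensity p σ y c) + ‖y‖ ^ 2 / (2 * σ ^ 2) =
      Real.log (p c) + Real.log (1 / (Real.pi * (2 * σ ^ 2)) ^ ((n : ℝ) / 2)) -
        ‖c‖ ^ 2 / (2 * σ ^ 2) + inner ℝ c y / σ ^ 2 := by
  have hA : 0 < 1 / (Real.pi * (2 * σ ^ 2)) ^ ((n : ℝ) / 2) := by
    have := Real.pi_pos
    positivity
  rw [jointDensity, gaussKernel, Real.log_mul hc.ne' (by positivity),
    Real.log_mul hA.ne' (Real.exp_pos _).ne', Real.log_exp, norm_sub_sq_real, real_inner_comm]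
  field_simp
  ring

lemma pos_of_mem_argmaxSet_jointDensity (hpos : ∃ c, 0 < p c) (hσ : 0 < σ)
    {y c : EuclideanSpace ℝ (Fin n)} (hc : c ∈ argmaxSet (jointDensity p σ y)) : 0 < p c := by
  obtain ⟨x, hx⟩ := hpos
  have h1 : 0 < jointDensity p σ y x := mul_pos hx (gaussKernel_pos (by positivity) _)
  have h2 : 0 < jointDensity p σ y c := h1.trans_le (hc x)
  exact pos_of_mul_pos_left h2 (gaussKernel_pos (by positivity) _).le

/-- For almost every `y`, the joint density has exactly one maximizer `c`, depending measurably on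
`y`: it is a multiple of the gradient of the convex Lipschitz function
`y ↦ max_c log (jointDensity p σ y c) + ‖y‖² / (2 σ²)`. -/
lemma exists_measurable_argmaxSet_jointDensity_eq_singleton (hp : Continuous p)
    (hpos : ∃ c, 0 < p c) (hσ : 0 < σ) (hr : ∀ c, r < ‖c‖ → p c = 0) :
    ∃ f : EuclideanSpace ℝ (Fin n) → EuclideanSpace ℝ (Fin n), Measurable f ∧
      ∀ᵐ y ∂(volume : Measure (EuclideanSpace ℝ (Fin n))),
        argmaxSet (jointDensity p σ y) = {f y} := by
  -- `m` is an arbitrary selection with no measurability; it only serves to define ψ.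
  choose m hm using exists_mem_argmaxSet_jointDensity (σ := σ) hp hr
  set ψ : EuclideanSpace ℝ (Fin n) → ℝ :=
    fun y => Real.log (jointDensity p σ y (m y)) + ‖y‖ ^ 2 / (2 * σ ^ 2) with hψ
  have hψ_eq : ∀ y c, c ∈ argmaxSet (jointDensity p σ y) →
      ψ y = Real.log (jointDensity p σ y c) + ‖y‖ ^ 2 / (2 * σ ^ 2) := fun y c hc => by
    rw [hψ, le_antisymm (hm y c) (hc (m y))]
  -- c / σ² is a subgradient of ψ at y, because c is a competitor at every other point z.
  have hsub : ∀ y c, c ∈ argmaxSet (jointDensity p σ y) → ∀ z,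
      ψ y - inner ℝ c y / σ ^ 2 ≤ ψ z - inner ℝ c z / σ ^ 2 := by
    intro y c hc z
    have hpc := pos_of_mem_argmaxSet_jointDensity hpos hσ hc
    have hz : Real.log (jointDensity p σ z c) ≤ Real.log (jointDensity p σ z (m z)) :=
      Real.log_le_log (mul_pos hpc (gaussKernel_pos (by positivity) _)) (hm z c)
    have h1 := log_jointDensity_add hσ hpc y
    have h2 := log_jointDensity_add hσ hpc z
    have h3 := hψ_eq y c hc
    have h4 : ψ z = Real.log (jointDensity p σ z (m z)) + ‖z‖ ^ 2 / (2 * σ ^ 2) := rfl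
    linarith
  have hr0 : 0 ≤ r := by
    obtain ⟨x, hx⟩ := hpos
    exact (norm_nonneg x).trans (not_lt.1 fun h => hx.ne' (hr x h))
  -- Maximizers have p > 0, hence norm at most r, which bounds the subgradients by r / σ².
  have hlip : LipschitzWith (Real.toNNReal (r / σ ^ 2)) ψ := by
    refine LipschitzWith.of_le_add_mul _ fun y z => ?_
    have h1 := hsub y (m y) (hm y) z
    have h2 : inner ℝ (m y) (y - z) ≤ r * ‖y - z‖ := by
      refine (real_inner_le_norm _ _).trans ?_
      gcongr
      exact not_lt.1 fun h =>
        (pos_of_mem_argmaxSet_jointDensity hpos hσ (hm y)).ne' (hr _ h)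
    rw [inner_sub_right] at h2
    have h3 := div_le_div_of_nonneg_right h2 (sq_nonneg σ)
    rw [sub_div, mul_div_right_comm] at h3
    rw [Real.coe_toNNReal _ (by positivity), dist_eq_norm]
    linarith
  -- `fderiv` is zero where ψ is not differentiable, so this witness is total and measurable.
  refine ⟨fun y => σ ^ 2 • (InnerProductSpace.toDual ℝ (EuclideanSpace ℝ (Fin n))).symm
    (fderiv ℝ ψ y), ?_, ?_⟩
  · exact ((InnerProductSpace.toDual ℝ
      (EuclideanSpace ℝ (Fin n))).symm.continuous.measurable.comp
        (measurable_fderiv ℝ ψ)).const_smul (σ ^ 2)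
  · filter_upwards [hlip.ae_differentiableAt (μ := volume)] with y hy
    have hmem : ∀ c ∈ argmaxSet (jointDensity p σ y), c = σ ^ 2 •
        (InnerProductSpace.toDual ℝ (EuclideanSpace ℝ (Fin n))).symm (fderiv ℝ ψ y) := by
      intro c hc
      have hd : HasFDerivAt (fun z => ψ z - ((σ ^ 2)⁻¹ • innerSL ℝ c) z)
          (fderiv ℝ ψ y - (σ ^ 2)⁻¹ • innerSL ℝ c) y :=
        hy.hasFDerivAt.sub ((σ ^ 2)⁻¹ • innerSL ℝ c).hasFDerivAt
      have hmin : IsLocalMin (fun z => ψ z - ((σ ^ 2)⁻¹ • innerSL ℝ c) z) y :=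
        Eventually.of_forall fun z => by
          simpa [inv_mul_eq_div] using hsub y c hc z
      have h0 := sub_eq_zero.1 (hmin.hasFDerivAt_eq_zero hd)
      rw [h0, map_smulₛₗ]
      have : (InnerProductSpace.toDual ℝ (EuclideanSpace ℝ (Fin n))).symm (innerSL ℝ c) = c :=
        (InnerProductSpace.toDual ℝ (EuclideanSpace ℝ (Fin n))).symm_apply_apply c
      rw [this]
      simp [smul_smul, hσ.ne']
    exact Set.eq_singleton_iff_unique_mem.2 ⟨hmem (m y) (hm y) ▸ hm y, hmem⟩

/-- The proximal operator of `-σ² log p` returns the maximizers of the joint density. -/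
lemma proxSet_scaledNegLog (hp0 : ∀ c, 0 ≤ p c) (hpos : ∃ c, 0 < p c) (hσ : 0 < σ)
    (y : EuclideanSpace ℝ (Fin n)) :
    proxSet (scaledNegLog σ p) y = argmaxSet (jointDensity p σ y) := by
  set Φ : EuclideanSpace ℝ (Fin n) → EReal :=
    fun c => ((1 / 2 * ‖y - c‖ ^ 2 : ℝ) : EReal) + scaledNegLog σ p c
  have htop : ∀ c, p c = 0 → Φ c = ⊤ := by
    intro c hc
    have h1 : ((σ ^ 2 : ℝ) : EReal) * ⊥ = ⊥ := EReal.coe_mul_bot_of_pos (by positivity)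
    simp only [Φ, scaledNegLog, hc, ENNReal.ofReal_zero, ENNReal.log_zero, h1, EReal.neg_bot]
    exact EReal.coe_add_top _
  have hcoe : ∀ c, 0 < p c → Φ c =
      ((1 / 2 * ‖y - c‖ ^ 2 - σ ^ 2 * Real.log (p c) : ℝ) : EReal) := by
    intro c hc
    simp only [Φ, scaledNegLog, ENNReal.log_ofReal_of_pos hc]
    norm_cast
  have hlog : ∀ c, 0 < p c → 1 / 2 * ‖y - c‖ ^ 2 - σ ^ 2 * Real.log (p c) =
      σ ^ 2 * Real.log (1 / (Real.pi * (2 * σ ^ 2)) ^ ((n : ℝ) / 2)) -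
        σ ^ 2 * Real.log (jointDensity p σ y c) := by
    intro c hc
    have h := log_jointDensity_add hσ hc y
    rw [← eq_sub_iff_add_eq] at h
    rw [h, norm_sub_sq_real, real_inner_comm]
    field_simp
    ring
  have hJ : ∀ c, 0 < p c → 0 < jointDensity p σ y c := fun c hc =>
    mul_pos hc (gaussKernel_pos (by positivity) _)
  have hle : ∀ c, 0 < p c → ∀ z, Φ c ≤ Φ z ↔ jointDensity p σ y z ≤ jointDensity p σ y c := by
    intro c hc z
    rcases (hp0 z).eq_or_lt with hz | hz
    · rw [htop z hz.symm]
      simp only [le_top, true_iff]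
      rw [jointDensity, ← hz, zero_mul]
      exact (hJ c hc).le
    · rw [hcoe c hc, hcoe z hz, EReal.coe_le_coe_iff, hlog c hc, hlog z hz,
        sub_le_sub_iff_left, mul_le_mul_iff_right₀ (by positivity),
        Real.log_le_log_iff (hJ z hz) (hJ c hc)]
  ext c
  constructor
  -- Where p vanishes the objective is ⊤, while it is finite somewhere; hence a minimizer has p > 0.
  · intro (hc : ∀ z, Φ c ≤ Φ z)
    have hpc : 0 < p c := by
      refine (hp0 c).lt_of_ne' fun h => ?_
      obtain ⟨x, hx⟩ := hpos
      have := hc x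
      rw [htop c h, hcoe x hx, top_le_iff] at this
      exact EReal.coe_ne_top _ this
    exact fun z => (hle c hpc z).1 (hc z)
  · intro hc
    exact fun z => (hle c (pos_of_mem_argmaxSet_jointDensity hpos hσ hc) z).2 (hc z)

end Maximizers

/-! ### The posterior density. -/

section Conditional

variable {n : ℕ} {p : EuclideanSpace ℝ (Fin n) → ℝ} {σ r : ℝ}

lemma integrable_jointDensity (hp : Continuous p) (hr : ∀ c, r < ‖c‖ → p c = 0)
    (y : EuclideanSpace ℝ (Fin n)) : Integrable (jointDensity p σ y) :=
  (continuous_jointDensity hp σ y).integrable_of_hasCompactSupport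
    (hasCompactSupport_jointDensity hr y)

lemma integral_jointDensity_pos (hp : Continuous p) (hp0 : ∀ c, 0 ≤ p c) (hpos : ∃ c, 0 < p c)
    (hσ : 0 < σ) (hr : ∀ c, r < ‖c‖ → p c = 0) (y : EuclideanSpace ℝ (Fin n)) :
    0 < ∫ c, jointDensity p σ y c := by
  obtain ⟨x, hx⟩ := hpos
  exact (continuous_jointDensity hp σ y).integral_pos_of_hasCompactSupport_nonneg_nonzero
    (hasCompactSupport_jointDensity hr y) (jointDensity_nonneg hp0 hσ y)
    (mul_pos hx (gaussKernel_pos (by positivity) _)).ne'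

/-- The conditional law of the signal given the observation has density proportional to the joint
density. -/
lemma ae_isContinuousDensity_condDistrib {Ω : Type*} [MeasurableSpace Ω] {P : Measure Ω}
    [IsProbabilityMeasure P] {X Y : Ω → EuclideanSpace ℝ (Fin n)} (hX : Measurable X)
    (hY : Measurable Y) (hp : Continuous p) (hp0 : ∀ c, 0 ≤ p c) (hpos : ∃ c, 0 < p c)
    (hσ : 0 < σ) (hr : ∀ c, r < ‖c‖ → p c = 0)
    (hjoint : P.map (fun ω => (Y ω, X ω)) =
      (volume.prod volume).withDensity fun z => ENNReal.ofReal (jointDensity p σ z.1 z.2)) :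
    ∀ᵐ y ∂(volume : Measure (EuclideanSpace ℝ (Fin n))),
      IsContinuousDensity (condDistrib X Y P y)
        (fun c => (∫ x, jointDensity p σ y x)⁻¹ * jointDensity p σ y c) := by
  have hJ := (continuous_uncurry_jointDensity hp σ).measurable
  set Z : EuclideanSpace ℝ (Fin n) → ℝ := fun y => ∫ c, jointDensity p σ y c with hZ_def
  have hZ : Measurable Z := hJ.stronglyMeasurable.integral_prod_right'.measurable
  have hZpos : ∀ y, 0 < Z y := integral_jointDensity_pos hp hp0 hpos hσ hr
  have hlint : ∀ y, ∫⁻ c, ENNReal.ofReal (jointDensity p σ y c) = ENNReal.ofReal (Z y) :=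
    fun y => (ofReal_integral_eq_lintegral_ofReal (integrable_jointDensity hp hr y)
      (ae_of_all _ (jointDensity_nonneg hp0 hσ y))).symm
  have hmapY : P.map Y = volume.withDensity fun y => ENNReal.ofReal (Z y) := by
    have hfst : P.map Y = (P.map fun ω => (Y ω, X ω)).map Prod.fst := by
      rw [Measure.map_map measurable_fst (hY.prodMk hX)]
      rfl
    refine Measure.ext_of_lintegral _ fun F hF => ?_
    rw [hfst, hjoint, lintegral_map hF measurable_fst,
      lintegral_withDensity_eq_lintegral_mul _ hJ.ennreal_ofReal (by fun_prop),
      lintegral_withDensity_eq_lintegral_mul _ hZ.ennreal_ofReal hF,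
      lintegral_prod _ (by fun_prop)]
    refine lintegral_congr fun y => ?_
    simp only [Pi.mul_apply]
    rw [lintegral_mul_const _ (by fun_prop), hlint]
  have hdens : Measurable (Function.uncurry fun y c =>
      ENNReal.ofReal ((Z y)⁻¹ * jointDensity p σ y c)) := by
    unfold Function.uncurry
    fun_prop
  set κ : Kernel (EuclideanSpace ℝ (Fin n)) (EuclideanSpace ℝ (Fin n)) :=
    Kernel.withDensity (Kernel.const _ volume)
      fun y c => ENNReal.ofReal ((Z y)⁻¹ * jointDensity p σ y c) with hκ_def
  have hκ : ∀ y, κ y = volume.withDensity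
      fun c => ENNReal.ofReal ((Z y)⁻¹ * jointDensity p σ y c) := fun y => by
    rw [hκ_def, Kernel.withDensity_apply _ hdens, Kernel.const_apply]
  have hmul : ∀ y c, ENNReal.ofReal ((Z y)⁻¹ * jointDensity p σ y c) =
      (ENNReal.ofReal (Z y))⁻¹ * ENNReal.ofReal (jointDensity p σ y c) := fun y c => by
    rw [ENNReal.ofReal_mul (inv_nonneg.2 (hZpos y).le), ENNReal.ofReal_inv_of_pos (hZpos y)]
  have hZ0 : ∀ y, ENNReal.ofReal (Z y) ≠ 0 := fun y => (ENNReal.ofReal_pos.2 (hZpos y)).ne'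
  have : IsMarkovKernel κ := ⟨fun y => ⟨by
    rw [hκ, withDensity_apply _ MeasurableSet.univ, Measure.restrict_univ]
    simp_rw [hmul]
    rw [lintegral_const_mul _ (by fun_prop), hlint,
      ENNReal.inv_mul_cancel (hZ0 y) ENNReal.ofReal_ne_top]⟩⟩
  have hcomp : P.map (fun ω => (Y ω, X ω)) = P.map Y ⊗ₘ κ := by
    refine Measure.ext_of_lintegral _ fun F hF => ?_
    rw [Measure.lintegral_compProd hF, hjoint,
      lintegral_withDensity_eq_lintegral_mul _ hJ.ennreal_ofReal hF,
      lintegral_prod _ (by fun_prop), hmapY,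
      lintegral_withDensity_eq_lintegral_mul _ hZ.ennreal_ofReal hF.lintegral_kernel_prod_right']
    refine lintegral_congr fun y => ?_
    simp only [Pi.mul_apply]
    rw [hκ, lintegral_withDensity_eq_lintegral_mul _ (by fun_prop) (by fun_prop)]
    simp only [Pi.mul_apply, hmul, mul_assoc]
    rw [lintegral_const_mul _ (by fun_prop), ← mul_assoc,
      ENNReal.mul_inv_cancel (hZ0 y) ENNReal.ofReal_ne_top, one_mul]
  have hae := condDistrib_ae_eq_of_measure_eq_compProd Y hX.aemeasurable hcomp
  rw [hmapY] at hae
  -- The law of Y has the everywhere positive density Z, so statements holding almost everywhere for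
  -- that law also hold Lebesgue-almost everywhere.
  have hac := withDensity_absolutelyContinuous' (μ := volume) hZ.ennreal_ofReal.aemeasurable
    (ae_of_all _ hZ0)
  filter_upwards [hac.ae_le hae] with y hy
  refine ⟨(continuous_jointDensity hp σ y).const_mul _,
    fun c => mul_nonneg (inv_nonneg.2 (hZpos y).le) (jointDensity_nonneg hp0 hσ y c), ?_⟩
  rw [hy, hκ]

lemma argmaxSet_const_mul {E : Type*} {a : ℝ} (ha : 0 < a) (q : E → ℝ) :
    argmaxSet (fun c => a * q c) = argmaxSet q := by
  ext c
  simp [argmaxSet, mul_le_mul_iff_right₀ ha]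

end Conditional

/-! ### The limit of the expected loss. -/

section LimitLoss

variable {n : ℕ} {p : EuclideanSpace ℝ (Fin n) → ℝ} {σ r : ℝ}

/-- This supplies an integrable bound in y, uniform in c. For ‖c‖ ≤ r, ‖y‖² ≤ 2‖y - c‖² + 2r²;
dividing by 4σ² trades the parameter 2σ² for 4σ² and costs the factor exp(r² / (2σ²)). -/
lemma exists_jointDensity_le_mul_gaussKernel (hp : Continuous p) (hp0 : ∀ c, 0 ≤ p c)
    (hσ : 0 < σ) (hr : ∀ c, r < ‖c‖ → p c = 0) :
    ∃ D : ℝ, ∀ y c, jointDensity p σ y c ≤ D * gaussKernel (4 * σ ^ 2) y := by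
  obtain ⟨x, hx⟩ := hp.exists_forall_ge_of_hasCompactSupport
    (hasCompactSupport_of_eq_zero_of_lt_norm hr)
  have hpi := Real.pi_pos
  set A := 1 / (Real.pi * (2 * σ ^ 2)) ^ ((n : ℝ) / 2) with hA
  set B := 1 / (Real.pi * (4 * σ ^ 2)) ^ ((n : ℝ) / 2) with hB
  have hA0 : 0 < A := by positivity
  have hB0 : 0 < B := by positivity
  refine ⟨p x * A * Real.exp (r ^ 2 / (2 * σ ^ 2)) / B, fun y c => ?_⟩
  have hrhs : p x * A * Real.exp (r ^ 2 / (2 * σ ^ 2)) / B * gaussKernel (4 * σ ^ 2) y =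
      p x * (A * Real.exp (r ^ 2 / (2 * σ ^ 2) + -(‖y‖ ^ 2 / (4 * σ ^ 2)))) := by
    rw [gaussKernel, ← hB, Real.exp_add]
    field_simp
  have hpx := hp0 x
  rw [hrhs]
  by_cases hc : r < ‖c‖
  · rw [jointDensity, hr c hc, zero_mul]
    positivity
  · rw [jointDensity, gaussKernel, ← hA]
    have hexp : -(‖y - c‖ ^ 2 / (2 * σ ^ 2)) ≤
        r ^ 2 / (2 * σ ^ 2) + -(‖y‖ ^ 2 / (4 * σ ^ 2)) := by
      have h1 : ‖y‖ ≤ ‖y - c‖ + ‖c‖ := by simpa using norm_add_le (y - c) c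
      have h2 : ‖y‖ ^ 2 ≤ 2 * ‖y - c‖ ^ 2 + 2 * r ^ 2 := by
        have h3 : ‖y‖ ^ 2 ≤ (‖y - c‖ + r) ^ 2 :=
          pow_le_pow_left₀ (norm_nonneg y) (h1.trans (by linarith [not_lt.1 hc])) 2
        nlinarith [sq_nonneg (‖y - c‖ - r)]
      have h4 : (r ^ 2 / (2 * σ ^ 2) + -(‖y‖ ^ 2 / (4 * σ ^ 2))) - -(‖y - c‖ ^ 2 / (2 * σ ^ 2)) =
          (2 * ‖y - c‖ ^ 2 + 2 * r ^ 2 - ‖y‖ ^ 2) / (4 * σ ^ 2) := by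
        field_simp
        ring
      rw [← sub_nonneg, h4]
      exact div_nonneg (by linarith) (by positivity)
    have := hx c
    gcongr

lemma gaussKernel_le {s : ℝ} (hs : 0 < s) (z : EuclideanSpace ℝ (Fin n)) :
    gaussKernel s z ≤ 1 / (Real.pi * s) ^ ((n : ℝ) / 2) := by
  have := Real.pi_pos
  refine mul_le_of_le_one_right (by positivity) (Real.exp_le_one_iff.2 ?_)
  exact neg_nonpos.2 (by positivity)

lemma expectedLoss_eq {Ω : Type*} [MeasurableSpace Ω] {P : Measure Ω}
    [IsProbabilityMeasure P] {X Y : Ω → EuclideanSpace ℝ (Fin n)} (hX : Measurable X)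
    (hY : Measurable Y) (hp : Continuous p) (hp0 : ∀ c, 0 ≤ p c) (hσ : 0 < σ)
    (hjoint : P.map (fun ω => (Y ω, X ω)) =
      (volume.prod volume).withDensity fun z => ENNReal.ofReal (jointDensity p σ z.1 z.2))
    {f : EuclideanSpace ℝ (Fin n) → EuclideanSpace ℝ (Fin n)} (hf : Measurable f)
    {γ : ℝ} (hγ : 0 < γ) :
    expectedLoss P X Y f γ =
      1 - ∫ y, ∫ c, gaussKernel (γ ^ 2) (f y - c) * jointDensity p σ y c := by
  have hK : Measurable fun z : EuclideanSpace ℝ (Fin n) × EuclideanSpace ℝ (Fin n) =>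
      gaussKernel (γ ^ 2) (f z.1 - z.2) :=
    (continuous_gaussKernel _).measurable.comp (by fun_prop)
  have hbound : ∀ z, ‖gaussKernel (γ ^ 2) (z : EuclideanSpace ℝ (Fin n))‖ ≤
      1 / (Real.pi * γ ^ 2) ^ ((n : ℝ) / 2) := fun z => by
    rw [Real.norm_of_nonneg (gaussKernel_pos (by positivity) z).le]
    exact gaussKernel_le (by positivity) z
  have : IsProbabilityMeasure (P.map fun ω => (Y ω, X ω)) :=
    Measure.isProbabilityMeasure_map (hY.prodMk hX).aemeasurable
  have hint : Integrable (fun z : EuclideanSpace ℝ (Fin n) × EuclideanSpace ℝ (Fin n) =>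
      gaussKernel (γ ^ 2) (f z.1 - z.2)) (P.map fun ω => (Y ω, X ω)) :=
    .of_bound hK.aestronglyMeasurable _ (ae_of_all _ fun z => hbound _)
  have hint' : Integrable (fun ω => gaussKernel (γ ^ 2) (f (Y ω) - X ω)) P :=
    hint.comp_measurable (hY.prodMk hX)
  calc expectedLoss P X Y f γ = ∫ ω, (1 - gaussKernel (γ ^ 2) (f (Y ω) - X ω)) ∂P := rfl
    _ = 1 - ∫ ω, gaussKernel (γ ^ 2) (f (Y ω) - X ω) ∂P := by
      rw [integral_sub (integrable_const _) hint']
      simp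
    _ = 1 - ∫ z, gaussKernel (γ ^ 2) (f z.1 - z.2) ∂(P.map fun ω => (Y ω, X ω)) := by
      rw [integral_map (hY.prodMk hX).aemeasurable hK.aestronglyMeasurable]
    _ = _ := by rw [integral_eq_of_eq_withDensity_jointDensity hp hp0 hσ hjoint _ hint]

lemma integrable_jointDensity_graph (hp : Continuous p) (hp0 : ∀ c, 0 ≤ p c) (hσ : 0 < σ)
    (hr : ∀ c, r < ‖c‖ → p c = 0)
    {f : EuclideanSpace ℝ (Fin n) → EuclideanSpace ℝ (Fin n)} (hf : Measurable f) :
    Integrable fun y => jointDensity p σ y (f y) := by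
  obtain ⟨D, hD⟩ := exists_jointDensity_le_mul_gaussKernel hp hp0 hσ hr
  refine Integrable.mono' ((integrable_gaussKernel (s := 4 * σ ^ 2) (by positivity)).const_mul D)
    ?_ (ae_of_all _ fun y => ?_)
  · exact ((continuous_uncurry_jointDensity hp σ).measurable.comp
      (measurable_id.prodMk hf)).aestronglyMeasurable
  · rw [Real.norm_of_nonneg (jointDensity_nonneg hp0 hσ _ _)]
    exact hD y (f y)

/-- The limit loss of `f` is `1 - ∫ p(f y) k(y - f y) dy`. -/
lemma hasLimitLoss_of_measurable {Ω : Type*} [MeasurableSpace Ω] {P : Measure Ω}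
    [IsProbabilityMeasure P] {X Y : Ω → EuclideanSpace ℝ (Fin n)} (hX : Measurable X)
    (hY : Measurable Y) (hp : Continuous p) (hp0 : ∀ c, 0 ≤ p c) (hσ : 0 < σ)
    (hr : ∀ c, r < ‖c‖ → p c = 0)
    (hjoint : P.map (fun ω => (Y ω, X ω)) =
      (volume.prod volume).withDensity fun z => ENNReal.ofReal (jointDensity p σ z.1 z.2))
    {f : EuclideanSpace ℝ (Fin n) → EuclideanSpace ℝ (Fin n)} (hf : Measurable f) :
    HasLimitLoss P X Y f (1 - ∫ y, jointDensity p σ y (f y)) := by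
  obtain ⟨D, hD⟩ := exists_jointDensity_le_mul_gaussKernel hp hp0 hσ hr
  have hJ := (continuous_uncurry_jointDensity hp σ).measurable
  have hlim : Tendsto
      (fun γ : ℝ => ∫ y, ∫ c, gaussKernel (γ ^ 2) (f y - c) * jointDensity p σ y c)
      (𝓝[>] 0) (𝓝 (∫ y, jointDensity p σ y (f y))) := by
    refine tendsto_integral_filter_of_dominated_convergence
      (fun y => D * gaussKernel (4 * σ ^ 2) y) ?_ ?_
      ((integrable_gaussKernel (by positivity)).const_mul D) ?_
    · refine .of_forall fun γ => ?_
      have hm : Measurable fun z : EuclideanSpace ℝ (Fin n) × EuclideanSpace ℝ (Fin n) =>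
          gaussKernel (γ ^ 2) (f z.1 - z.2) * jointDensity p σ z.1 z.2 :=
        ((continuous_gaussKernel _).measurable.comp (by fun_prop)).mul hJ
      exact hm.stronglyMeasurable.integral_prod_right'.aestronglyMeasurable
    -- The bound on J does not depend on c and the kernel has mass one, so averaging over c
    -- preserves the bound for every γ > 0.
    · filter_upwards [self_mem_nhdsWithin] with γ hγ
      have hγ : 0 < γ ^ 2 := pow_pos hγ 2
      refine ae_of_all _ fun y => ?_
      have hint : Integrable fun c => gaussKernel (γ ^ 2) (f y - c) :=
        (integrable_gaussKernel hγ).comp_sub_left (f y)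
      calc ‖∫ c, gaussKernel (γ ^ 2) (f y - c) * jointDensity p σ y c‖
          ≤ ∫ c, gaussKernel (γ ^ 2) (f y - c) * (D * gaussKernel (4 * σ ^ 2) y) := by
            refine norm_integral_le_of_norm_le (hint.mul_const _) (ae_of_all _ fun c => ?_)
            have h1 := (gaussKernel_pos hγ (f y - c)).le
            rw [Real.norm_of_nonneg (mul_nonneg h1 (jointDensity_nonneg hp0 hσ _ _))]
            exact mul_le_mul_of_nonneg_left (hD y c) h1
        _ = D * gaussKernel (4 * σ ^ 2) y := by
            rw [integral_mul_const, integral_sub_left_eq_self (gaussKernel (γ ^ 2)) volume (f y),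
              integral_gaussKernel hγ, one_mul]
    · exact ae_of_all _ fun y => tendsto_integral_gaussKernel_mul
        (integrable_jointDensity hp hr y) (continuous_jointDensity hp σ y) (f y)
  refine (hlim.const_sub 1).congr' ?_
  filter_upwards [self_mem_nhdsWithin] with γ hγ
  exact (expectedLoss_eq hX hY hp hp0 hσ hjoint hf hγ).symm

end LimitLoss

theorem mainTheorem1 {Ω : Type*} [MeasurableSpace Ω] (P : Measure Ω) [IsProbabilityMeasure P]
    (n : ℕ) (X V Y : Ω → EuclideanSpace ℝ (Fin n)) (p : EuclideanSpace ℝ (Fin n) → ℝ) (σ : ℝ)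
    (hX : Measurable X) (hV : Measurable V)
    (hp : IsContinuousDensity (P.map X) p)
    (hbdd : ∃ r : ℝ, ∀ᵐ ω ∂P, ‖X ω‖ ≤ r)
    (hgauss : P.map V = stdGaussian (EuclideanSpace ℝ (Fin n)))
    (hindep : IndepFun X V P)
    (hσ : 0 < σ)
    (hY : ∀ ω, Y ω = X ω + σ • V ω) :
    -- the limit loss is well defined for every measurable `f`
    (∀ f : EuclideanSpace ℝ (Fin n) → EuclideanSpace ℝ (Fin n), Measurable f →
      ∃ ℓ, HasLimitLoss P X Y f ℓ) ∧
    -- it has a measurable minimizer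
    (∃ f, IsLimitLossMinimizer P X Y f) ∧
    -- every minimizer is, almost everywhere, the MAP estimate and the proximal operator
    (∀ f, IsLimitLossMinimizer P X Y f →
      ∀ᵐ y ∂(volume : Measure (EuclideanSpace ℝ (Fin n))),
        (∃ q, IsContinuousDensity (condDistrib X Y P y) q ∧ argmaxSet q = {f y}) ∧
        proxSet (scaledNegLog σ p) y = {f y}) := by
  obtain ⟨r, hr⟩ := hbdd
  have hYm : Measurable Y := by
    rw [funext hY]
    fun_prop
  have hpc := hp.continuous
  have hp0 := hp.nonneg
  have : IsProbabilityMeasure (P.map X) := Measure.isProbabilityMeasure_map hX.aemeasurable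
  have hpos := hp.exists_pos
  have hr' : ∀ c, r < ‖c‖ → p c = 0 := fun c => hp.eq_zero_of_lt_norm hX hr
  have hjoint := map_prodMk_eq_withDensity_jointDensity hX hV hp hgauss hindep hσ hY
  have hloss : ∀ f : EuclideanSpace ℝ (Fin n) → EuclideanSpace ℝ (Fin n), Measurable f →
      HasLimitLoss P X Y f (1 - ∫ y, jointDensity p σ y (f y)) := fun f hf =>
    hasLimitLoss_of_measurable hX hYm hpc hp0 hσ hr' hjoint hf
  have hint : ∀ f : EuclideanSpace ℝ (Fin n) → EuclideanSpace ℝ (Fin n), Measurable f →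
      Integrable fun y => jointDensity p σ y (f y) := fun f hf =>
    integrable_jointDensity_graph hpc hp0 hσ hr' hf
  obtain ⟨f₀, hf₀, hmax⟩ :=
    exists_measurable_argmaxSet_jointDensity_eq_singleton hpc hpos hσ hr'
  have hle : ∀ f : EuclideanSpace ℝ (Fin n) → EuclideanSpace ℝ (Fin n),
      (fun y => jointDensity p σ y (f y)) ≤ᵐ[volume] fun y => jointDensity p σ y (f₀ y) := by
    intro f
    filter_upwards [hmax] with y hy
    have hmem : f₀ y ∈ argmaxSet (jointDensity p σ y) := hy ▸ Set.mem_singleton _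
    exact hmem (f y)
  refine ⟨fun f hf => ⟨_, hloss f hf⟩, ⟨f₀, hf₀, _, hloss f₀ hf₀, fun g hg ℓ' hℓ' => ?_⟩, ?_⟩
  · rw [tendsto_nhds_unique hℓ' (hloss g hg)]
    exact sub_le_sub_left (integral_mono_ae (hint g hg) (hint f₀ hf₀) (hle g)) 1
  · rintro f ⟨hf, ℓ, hℓ, hmin⟩
    have h1 := hmin f₀ hf₀ _ (hloss f₀ hf₀)
    rw [tendsto_nhds_unique hℓ (hloss f hf)] at h1
    -- The integrand of f lies below that of f₀ almost everywhere; equal integrals force equality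
    -- almost everywhere, so f(y) is itself a maximizer.
    have heq := (integral_eq_iff_of_ae_le (hint f hf) (hint f₀ hf₀) (hle f)).1
      (le_antisymm (integral_mono_ae (hint f hf) (hint f₀ hf₀) (hle f)) (by linarith))
    filter_upwards [hmax, heq, ae_isContinuousDensity_condDistrib hX hYm hpc hp0 hpos hσ hr' hjoint]
      with y hy hfy hcond
    have hmem₀ : f₀ y ∈ argmaxSet (jointDensity p σ y) := hy ▸ Set.mem_singleton _
    have hmem : f y ∈ argmaxSet (jointDensity p σ y) := fun z => (hmem₀ z).trans hfy.ge
    have hff : f y = f₀ y := by rwa [hy] at hmem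
    rw [hff]
    refine ⟨⟨_, hcond, ?_⟩, ?_⟩
    · rw [argmaxSet_const_mul (inv_pos.2 (integral_jointDensity_pos hpc hp0 hpos hσ hr' y)), hy]
    · rw [proxSet_scaledNegLog hp0 hpos hσ, hy]
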